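/- Let $X$ be a connected smooth manifold, $x_0\in X$, let $\Gamma=\pi_1(X,x_0)$, and let $\pi:\tilde X\to X$ be a universal covering of $X$ (smooth, with $\tilde X$ simply connected), with a fixed point $\tilde x_0\in\pi^{-1}(x_0)$. Let $\Gamma$ act on $\tilde X$ by deck transformations: $\gamma\in\Gamma$ acts by the deck transformation that sends $\tilde x_0$ to the end point of the lift of $\gamma$ starting at $\tilde x_0$. By pulling back functions, $\Gamma$ acts on the space $C^\infty(\tilde X)$ of smooth functions $\tilde X\to\mathbb C$. For smooth complex-valued $1$-forms $\omega_1,\dots,\omega_r$ on $X$ and a smooth path $p:[0,1]\to X$, the iterated integral of length $r$ is $$\int_p\omega_1\cdots\omega_r=\int_{0\le t_1\le\dots\le t_r\le 1}p^*\omega_1(t_1)\cdots p^*\omega_r(t_r),$$ which is the constant $1$ for $r=0$. For an integer $s\ge 0$ let $B_s(X)$ be the space of all functions on the set of smooth paths in $X$ that are $\mathbb C$-linear combinations of iterated integrals of length $\le s$, let $B_s(X)_{x_0}$ be the space of restrictions of the elements of $B_s(X)$ to the set of smooth paths starting at $x_0$, and let $B_s(X)_{x_0}^{\rm hom}$ be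 the space of those elements of $B_s(X)_{x_0}$ that are invariant under homotopies of paths with fixed end points. Let $J\subset\mathbb Z\Gamma$ be the augmentation ideal, spanned by the elements $\gamma-1$, $\gamma\in\Gamma$, and for a $\mathbb Z\Gamma$-module $V$ let $\mathrm H^0_s(\Gamma,V)=\{v\in V: J^sv=0\}$. Every point $x\in\tilde X$ is the end point of some smooth path $\tilde p$ in $\tilde X$ starting at $\tilde x_0$. For $\omega\in B_s(X)_{x_0}^{\rm hom}$ the value $\int_{x_0}^x\omega:=\omega(\pi\circ\tilde p)$ depends only on $x$, and the function $x\mapsto\int_{x_0}^x\omega$ is smooth on $\tilde X$ and is a higher order invariant of order at most $s+1$, i.e. lies in $\mathrm H^0_{s+1}(\Gamma,C^\infty(\tilde X))$. The map $$\Psi: B_s(X)_{x_0}^{\rm hom}\to \mathrm H_{s+1}^0(\Gamma, C^\infty(\tilde X)),\qquad \omega\mapsto\Big(x\mapsto\int_{x_0}^x\omega\Big),$$ is $\mathbb C$-linear and injective. -/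

import Mathlib

open scoped Manifold ContDiff

noncomputable section

/-! ### Path spaces and iterated integrals -/

/-- The space `PX` of all smooth paths `[0,1] → X` in an `n`-dimensional smooth manifold `X`. -/
abbrev PathSpace (n : ℕ) (X : Type*) [TopologicalSpace X]
    [ChartedSpace (EuclideanSpace ℝ (Fin n)) X] : Type _ :=
  C^∞⟮𝓡∂ 1, unitInterval; 𝓡 n, X⟯

/-- The space `PX_{x₀}` of all smooth paths in `X` that start at `x₀`. -/
abbrev PathSpaceFrom (n : ℕ) {X : Type*} [TopologicalSpace X]
    [ChartedSpace (EuclideanSpace ℝ (Fin n)) X] (x₀ : X) : Type _ :=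
  {p : PathSpace n X // p 0 = x₀}

/-- The smooth complex-valued `1`-forms on `X`: the smooth sections of the bundle with fibres
`Hom_ℝ(T_x X, ℂ)`. -/
abbrev OneForm (n : ℕ) (X : Type*) [TopologicalSpace X]
    [ChartedSpace (EuclideanSpace ℝ (Fin n)) X] [IsManifold (𝓡 n) ∞ X] : Type _ :=
  Cₛ^∞⟮𝓡 n; EuclideanSpace ℝ (Fin n) →L[ℝ] ℂ,
    fun x : X => TangentSpace (𝓡 n) x →L[ℝ] Bundle.Trivial X ℂ x⟯

section IteratedIntegral

variable {n : ℕ} {X : Type*} [TopologicalSpace X] [ChartedSpace (EuclideanSpace ℝ (Fin n)) X]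
  [IsManifold (𝓡 n) ∞ X]

/-- The coefficient function `t ↦ η_{p(t)}(p'(t))` of the pullback `p^*η` of a `1`-form along a
smooth path; only its values for `t ∈ [0,1]` matter. -/
def pullbackCoeff (η : OneForm n X) (p : PathSpace n X) (t : ℝ) : ℂ :=
  η (p (Set.projIcc 0 1 zero_le_one t))
    (mfderivWithin 𝓘(ℝ, ℝ) (𝓡 n) (fun u : ℝ => p (Set.projIcc 0 1 zero_le_one u))
      (Set.Icc 0 1) t (1 : ℝ))

/-- The iterated integral of `ω₁ ⋯ ω_r` along the part of `p` over `[0,t]`, with the simplex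
ordered as `0 ≤ t₁ ≤ ⋯ ≤ t_r ≤ t`: the outermost integration is that of the last form. -/
def iteratedIntegralUpTo (p : PathSpace n X) : (r : ℕ) → (Fin r → OneForm n X) → ℝ → ℂ
  | 0, _, _ => 1
  | r + 1, w, t =>
      ∫ u in (0 : ℝ)..t,
        iteratedIntegralUpTo p r (Fin.init w) u * pullbackCoeff (w (Fin.last r)) p u

/-- The iterated integral `∫_p ω₁ ⋯ ω_r`. -/
def iteratedIntegral {r : ℕ} (w : Fin r → OneForm n X) (p : PathSpace n X) : ℂ :=
  iteratedIntegralUpTo p r w 1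

variable (n X) in
/-- `B_s(X)`: the functions on the path space which are `ℂ`-linear combinations of iterated
integrals of length at most `s`. -/
def iteratedIntegrals (s : ℕ) : Submodule ℂ (PathSpace n X → ℂ) :=
  Submodule.span ℂ {F | ∃ r ≤ s, ∃ w : Fin r → OneForm n X, F = iteratedIntegral w}

/-- `B_s(X)_{x₀}`: the restrictions of the elements of `B_s(X)` to the paths starting at `x₀`. -/
def iteratedIntegralsFrom (n : ℕ) {X : Type*} [TopologicalSpace X]
    [ChartedSpace (EuclideanSpace ℝ (Fin n)) X] [IsManifold (𝓡 n) ∞ X] (x₀ : X) (s : ℕ) :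
    Submodule ℂ (PathSpaceFrom n x₀ → ℂ) :=
  (iteratedIntegrals n X s).map
    (LinearMap.funLeft ℂ ℂ (Subtype.val : PathSpaceFrom n x₀ → PathSpace n X))

end IteratedIntegral

/-- The functions on `PX_{x₀}` which are invariant under homotopies with fixed end points. -/
def homotopyInvariantFrom (n : ℕ) {X : Type*} [TopologicalSpace X]
    [ChartedSpace (EuclideanSpace ℝ (Fin n)) X] (x₀ : X) :
    Submodule ℂ (PathSpaceFrom n x₀ → ℂ) where
  carrier := {F | ∀ p q : PathSpaceFrom n x₀,
    (p.1 : C(unitInterval, X)).HomotopicRel (q.1 : C(unitInterval, X)) {0, 1} → F p = F q}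
  zero_mem' := fun _ _ _ => rfl
  add_mem' := fun hF hG p q h => by
    simp only [Pi.add_apply, hF p q h, hG p q h]
  smul_mem' := fun c F hF p q h => by
    simp only [Pi.smul_apply, hF p q h]

/-- `B_s(X)_{x₀}^hom`: the homotopy-invariant elements of `B_s(X)_{x₀}`. -/
def homIteratedIntegralsFrom (n : ℕ) {X : Type*} [TopologicalSpace X]
    [ChartedSpace (EuclideanSpace ℝ (Fin n)) X] [IsManifold (𝓡 n) ∞ X] (x₀ : X) (s : ℕ) :
    Submodule ℂ (PathSpaceFrom n x₀ → ℂ) :=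
  iteratedIntegralsFrom n x₀ s ⊓ homotopyInvariantFrom n x₀

/-! ### Higher order invariants -/

/-- The augmentation ideal `J` of the group ring `ℤΓ`, spanned by the elements `γ - 1`. -/
def augmentationIdeal (Γ : Type*) [Group Γ] : Ideal (MonoidAlgebra ℤ Γ) :=
  Ideal.span (Set.range fun γ : Γ => MonoidAlgebra.single γ (1 : ℤ) - 1)

/-- `H^0_s(Γ, V)`: the elements of `V` annihilated by `J^s`, where the group ring `ℤΓ` acts on
`V` by the linear extension of the representation `ρ`. -/
def higherInvariants {Γ V : Type*} [Group Γ] [AddCommGroup V] [Module ℂ V]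
    (ρ : Representation ℂ Γ V) (s : ℕ) : Submodule ℂ V where
  carrier := {v | ∀ j ∈ augmentationIdeal Γ ^ s,
    MonoidAlgebra.lift ℤ (Module.End ℂ V) Γ ρ j v = 0}
  zero_mem' := fun _ _ => map_zero _
  add_mem' := fun hv hw j hj => by rw [map_add, hv j hj, hw j hj, add_zero]
  smul_mem' := fun c v hv j hj => by rw [map_smul, hv j hj, smul_zero]

/-- `C^∞(X)`: the complex-valued smooth functions on `X`. -/
def smoothFunctions (n : ℕ) (X : Type*) [TopologicalSpace X]
    [ChartedSpace (EuclideanSpace ℝ (Fin n)) X] : Submodule ℂ (X → ℂ) where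
  carrier := {f | ContMDiff (𝓡 n) 𝓘(ℝ, ℂ) ∞ f}
  zero_mem' := contMDiff_const
  add_mem' := fun hf hg => hf.add hg
  smul_mem' := fun c _ hf => (c • ContinuousLinearMap.id ℝ ℂ).contMDiff.comp hf

/-! ### The universal covering and its deck transformations -/

/-- `π : Y → X` is a universal covering of the smooth manifold `X`: the manifold `Y` is simply
connected and `π` is a covering map and a local diffeomorphism. -/
structure IsSmoothUniversalCovering (n : ℕ) {X Y : Type*} [TopologicalSpace X]
    [ChartedSpace (EuclideanSpace ℝ (Fin n)) X] [TopologicalSpace Y]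
    [ChartedSpace (EuclideanSpace ℝ (Fin n)) Y] (π : Y → X) : Prop where
  simplyConnectedSpace : SimplyConnectedSpace Y
  isCoveringMap : IsCoveringMap π
  isLocalDiffeomorph : IsLocalDiffeomorph (𝓡 n) (𝓡 n) ∞ π

namespace IsSmoothUniversalCovering

variable {n : ℕ} {X Y : Type*} [TopologicalSpace X]
    [ChartedSpace (EuclideanSpace ℝ (Fin n)) X] [TopologicalSpace Y]
    [ChartedSpace (EuclideanSpace ℝ (Fin n)) Y] {π : Y → X}

theorem contMDiff (hπ : IsSmoothUniversalCovering n π) : ContMDiff (𝓡 n) (𝓡 n) ∞ π :=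
  hπ.isLocalDiffeomorph.contMDiff

theorem existsUnique_deck (hπ : IsSmoothUniversalCovering n π) {x₀ : X} (e e' : π ⁻¹' {x₀}) :
    ∃! F : C(Y, Y), F e = e' ∧ π ∘ F = π := by
  have := hπ.simplyConnectedSpace
  have : LocallyPathConnectedSpace Y :=
    ChartedSpace.locallyPathConnectedSpace (EuclideanSpace ℝ (Fin n)) Y
  exact hπ.isCoveringMap.existsUnique_continuousMap_lifts ⟨π, hπ.isCoveringMap.continuous⟩
    (e : Y) (e' : Y) (e'.2.trans e.2.symm)

variable (hπ : IsSmoothUniversalCovering n π)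

/-- The deck transformation given by `γ ∈ π₁(X, x₀)`: the unique continuous `F : Y → Y` with
`π ∘ F = π` which sends the chosen base point `e` over `x₀` to the end point of the lift of `γ`
starting at `e`. -/
def deck {x₀ : X} (e : π ⁻¹' {x₀}) (γ : FundamentalGroup X x₀) : C(Y, Y) :=
  (hπ.existsUnique_deck e (hπ.isCoveringMap.monodromy γ e)).choose

theorem deck_base {x₀ : X} (e : π ⁻¹' {x₀}) (γ : FundamentalGroup X x₀) :
    hπ.deck e γ e = hπ.isCoveringMap.monodromy γ e :=
  (hπ.existsUnique_deck e (hπ.isCoveringMap.monodromy γ e)).choose_spec.1.1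

theorem comp_deck {x₀ : X} (e : π ⁻¹' {x₀}) (γ : FundamentalGroup X x₀) :
    π ∘ hπ.deck e γ = π :=
  (hπ.existsUnique_deck e (hπ.isCoveringMap.monodromy γ e)).choose_spec.1.2

theorem eq_deck {x₀ : X} (e : π ⁻¹' {x₀}) (γ : FundamentalGroup X x₀) (F : C(Y, Y))
    (h : F e = hπ.isCoveringMap.monodromy γ e) (h' : π ∘ F = π) : hπ.deck e γ = F :=
  (hπ.existsUnique_deck e (hπ.isCoveringMap.monodromy γ e)).unique
    ⟨hπ.deck_base e γ, hπ.comp_deck e γ⟩ ⟨h, h'⟩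

theorem deck_one {x₀ : X} (e : π ⁻¹' {x₀}) :
    hπ.deck e (1 : FundamentalGroup X x₀) = ContinuousMap.id Y := by
  refine hπ.eq_deck e _ _ ?_ rfl
  rw [FundamentalGroup.one_def, hπ.isCoveringMap.monodromy_refl]
  rfl

theorem deck_monodromy {x₀ : X} (e : π ⁻¹' {x₀}) (γ γ' : FundamentalGroup X x₀)
    (e' : π ⁻¹' {x₀}) :
    hπ.deck e γ (hπ.isCoveringMap.monodromy γ' e') =
      hπ.isCoveringMap.monodromy γ'
        ⟨hπ.deck e γ e', (congrFun (hπ.comp_deck e γ) e').trans e'.2⟩ := by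
  obtain ⟨α⟩ := γ'
  have hα : (α : C(unitInterval, X)) 0 = π (e' : Y) := α.source.trans e'.2.symm
  have hα' : (α : C(unitInterval, X)) 0 = π (hπ.deck e γ e') :=
    hα.trans (congrFun (hπ.comp_deck e γ) e').symm
  have h : (hπ.deck e γ).comp (hπ.isCoveringMap.liftPath α e' hα) =
      hπ.isCoveringMap.liftPath α (hπ.deck e γ e') hα' := by
    rw [IsCoveringMap.eq_liftPath_iff']
    refine ⟨?_, ?_⟩
    · rw [ContinuousMap.coe_comp, ← Function.comp_assoc, hπ.comp_deck,
        hπ.isCoveringMap.liftPath_lifts]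
    · rw [ContinuousMap.comp_apply, hπ.isCoveringMap.liftPath_zero]
  exact congrArg (fun F : C(unitInterval, Y) => F 1) h

theorem deck_mul {x₀ : X} (e : π ⁻¹' {x₀}) (γ γ' : FundamentalGroup X x₀) :
    hπ.deck e (γ * γ') = (hπ.deck e γ').comp (hπ.deck e γ) := by
  refine hπ.eq_deck e _ _ ?_ ?_
  · rw [ContinuousMap.comp_apply, hπ.deck_base, hπ.deck_monodromy,
      FundamentalGroup.mul_def, hπ.isCoveringMap.monodromy_trans_apply]
    congr 2
    exact Subtype.ext (hπ.deck_base e γ')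
  · rw [ContinuousMap.coe_comp, ← Function.comp_assoc, hπ.comp_deck, hπ.comp_deck]

theorem contMDiff_deck {x₀ : X} (e : π ⁻¹' {x₀}) (γ : FundamentalGroup X x₀) :
    ContMDiff (𝓡 n) (𝓡 n) ∞ (hπ.deck e γ) := by
  intro y
  have hy := hπ.isLocalDiffeomorph (hπ.deck e γ y)
  have hc : ∀ z, π (hπ.deck e γ z) = π z := congrFun (hπ.comp_deck e γ)
  have h : ContMDiffAt (𝓡 n) (𝓡 n) ∞ (hy.localInverse ∘ π) y := by
    refine ContMDiffAt.comp y ?_ (hπ.isLocalDiffeomorph.contMDiff y)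
    rw [← hc y]
    exact hy.localInverse_contMDiffAt
  refine h.congr_of_eventuallyEq ?_
  filter_upwards [(hπ.deck e γ).continuous.continuousAt.eventually
    hy.localInverse_eventuallyEq_left] with z hz
  exact (hz.symm.trans (congrArg hy.localInverse (hc z)))

/-- The action of `Γ = π₁(X, x₀)` on `C^∞(Y)` through deck transformations,
`(γ f)(y) = f(γ y)`. In Mathlib's `FundamentalGroup` the product `γ * γ'` is "first `γ'`, then
`γ`", so that pulling back along deck transformations is a left action. -/
def deckRep {x₀ : X} (e : π ⁻¹' {x₀}) :
    Representation ℂ (FundamentalGroup X x₀) (smoothFunctions n Y) where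
  toFun γ :=
    { toFun := fun f => ⟨(f : Y → ℂ) ∘ hπ.deck e γ, ContMDiff.comp f.2 (hπ.contMDiff_deck e γ)⟩
      map_add' := fun _ _ => rfl
      map_smul' := fun _ _ => rfl }
  map_one' := by
    refine LinearMap.ext fun f => Subtype.ext (funext fun y => ?_)
    change (f : Y → ℂ) (hπ.deck e 1 y) = (f : Y → ℂ) y
    rw [hπ.deck_one, ContinuousMap.id_apply]
  map_mul' γ γ' := by
    refine LinearMap.ext fun f => Subtype.ext (funext fun y => ?_)
    change (f : Y → ℂ) (hπ.deck e (γ * γ') y) = (f : Y → ℂ) (hπ.deck e γ' (hπ.deck e γ y))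
    rw [hπ.deck_mul, ContinuousMap.comp_apply]

/-- The projection `π ∘ p` to `X` of a smooth path `p` in `Y` starting at the base point `e`. -/
def projPath {x₀ : X} (e : π ⁻¹' {x₀}) (p : PathSpaceFrom n (e : Y)) : PathSpaceFrom n x₀ :=
  ⟨ContMDiffMap.comp ⟨π, hπ.contMDiff⟩ p.1, by
    change π (p.1 0) = x₀
    rw [p.2]
    exact e.2⟩

end IsSmoothUniversalCovering

end

open scoped Manifold ContDiff

/-! The proof rests on the composition formula: an iterated integral along a concatenation is the
sum, over all ways of cutting the word of forms in two, of an integral along the first path times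
one along the second (`listIntegral_concat`). With the first path fixed, the only full-length term
along the second path has coefficient 1, so prefixing a path changes a combination of iterated
integrals only by shorter ones (`exists_concat_eq_add`).

Order of invariance. Let `τ` run in the covering from the base point to its image under `γ`. For `p`
ending at `y`, the path `τ` followed by `γ p` ends at `γ y` and projects to the projection of `τ`
followed by that of `p`. Hence `γ - 1` lowers the length bound on functions given by iterated
integrals (`deckRep_sub_mem`). Functions of length less than 0 vanish, so `s + 1` factors from the
augmentation ideal kill everything of length at most `s`.

Smoothness. Near `y`, follow a fixed path to `y` and then a segment in a parametrization. The
composition formula leaves constants times integrals along segments, which depend smoothly on the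
end point (`contDiff_radialIntegral`).

Well-definedness comes from simple connectedness of the covering. Injectivity holds because every
smooth path from `x₀` lifts to a smooth path from the base point (`exists_projPath_eq`). -/

noncomputable section

/-! ### Pullbacks of one-forms along smooth maps and paths. -/

section Pullback

variable {n : ℕ} {X : Type*} [TopologicalSpace X] [ChartedSpace (EuclideanSpace ℝ (Fin n)) X]
  [IsManifold (𝓡 n) ∞ X]

/-- A `1`-form evaluated on a smooth vector field along the restriction of a smooth map from a
normed space to a set with unique derivatives is smooth. -/
theorem contDiffOn_oneForm_mfderivWithin {E : Type*} [NormedAddCommGroup E] [NormedSpace ℝ E]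
    (η : OneForm n X) {K : E → X} {S : Set E} (hK : ContMDiffOn 𝓘(ℝ, E) (𝓡 n) ∞ K S)
    (hS : UniqueMDiffOn 𝓘(ℝ, E) S) (v : E) :
    ContDiffOn ℝ ∞ (fun x => (η (K x) (mfderivWithin 𝓘(ℝ, E) (𝓡 n) K S x v) : ℂ)) S := by
  -- The constant field `v` is a smooth section of the tangent bundle of `E`; the tangent map of `K`
  -- carries it to a smooth field along `K`, to which the form is applied fibrewise.
  have h₁ : ContMDiffOn 𝓘(ℝ, E) 𝓘(ℝ, E).tangent ∞
      (fun x : E => (⟨x, v⟩ : TangentBundle 𝓘(ℝ, E) E)) S := by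
    refine ContMDiff.contMDiffOn fun x => ?_
    rw [Bundle.contMDiffAt_totalSpace]
    exact ⟨contMDiffAt_id, by simpa using contMDiffAt_const⟩
  have h₂ : ContMDiffOn 𝓘(ℝ, E) (𝓡 n).tangent ∞
      (fun x => (⟨K x, mfderivWithin 𝓘(ℝ, E) (𝓡 n) K S x v⟩ : TangentBundle (𝓡 n) X)) S :=
    (hK.contMDiffOn_tangentMapWithin (m := ∞) le_rfl hS).comp h₁ fun x hx => hx
  have h₃ := η.contMDiff.comp_contMDiffOn hK
  have h₄ := ContMDiffOn.clm_bundle_apply (F₁ := EuclideanSpace ℝ (Fin n)) (F₂ := ℂ)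
    (E₁ := fun x : X => TangentSpace (𝓡 n) x) (E₂ := Bundle.Trivial X ℂ)
    (b := K) (ϕ := fun x => η (K x)) (v := fun x => mfderivWithin 𝓘(ℝ, E) (𝓡 n) K S x v) h₃ h₂
  rw [← contMDiffOn_iff_contDiffOn]
  intro x hx
  exact (Bundle.contMDiffWithinAt_totalSpace.1 (h₄ x hx)).2

theorem uniqueMDiffOn_unitInterval : UniqueMDiffOn 𝓘(ℝ, ℝ) (Set.Icc (0 : ℝ) 1) :=
  (uniqueDiffOn_Icc zero_lt_one).uniqueMDiffOn

theorem PathSpace.contMDiffOn_projIcc {n : ℕ} {X : Type*} [TopologicalSpace X]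
    [ChartedSpace (EuclideanSpace ℝ (Fin n)) X] (p : PathSpace n X) :
    ContMDiffOn 𝓘(ℝ, ℝ) (𝓡 n) ∞ (fun u : ℝ => p (Set.projIcc 0 1 zero_le_one u))
      (Set.Icc 0 1) :=
  p.contMDiff.comp_contMDiffOn _root_.contMDiffOn_projIcc

theorem continuousOn_pullbackCoeff (η : OneForm n X) (p : PathSpace n X) :
    ContinuousOn (pullbackCoeff η p) (Set.Icc 0 1) :=
  (contDiffOn_oneForm_mfderivWithin η p.contMDiffOn_projIcc uniqueMDiffOn_unitInterval
    (1 : ℝ)).continuousOn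

/-- The chain rule for the pullback of a `1`-form. -/
theorem pullbackCoeff_of_eventuallyEq_comp {E : Type*} [NormedAddCommGroup E] [NormedSpace ℝ E]
    (η : OneForm n X) (p : PathSpace n X) {K : E → X} {S : Set E} {φ : ℝ → E} {φ' : E} {t : ℝ}
    (ht : t ∈ Set.Icc (0 : ℝ) 1) (hφ : HasDerivWithinAt φ φ' (Set.Icc 0 1) t)
    (hS : Set.MapsTo φ (Set.Icc 0 1) S)
    (hK : MDifferentiableWithinAt 𝓘(ℝ, E) (𝓡 n) K S (φ t))
    (h : (fun u : ℝ => p (Set.projIcc 0 1 zero_le_one u)) =ᶠ[nhdsWithin t (Set.Icc 0 1)] K ∘ φ) :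
    pullbackCoeff η p t = η (K (φ t)) (mfderivWithin 𝓘(ℝ, E) (𝓡 n) K S (φ t) φ') := by
  have h₀ : p (Set.projIcc 0 1 zero_le_one t) = K (φ t) := h.self_of_nhdsWithin ht
  have h₁ : HasMFDerivWithinAt 𝓘(ℝ, ℝ) (𝓡 n)
      (fun u : ℝ => p (Set.projIcc 0 1 zero_le_one u)) (Set.Icc 0 1) t
      ((mfderivWithin 𝓘(ℝ, E) (𝓡 n) K S (φ t)).comp
        (ContinuousLinearMap.toSpanSingleton ℝ φ' : ℝ →L[ℝ] E)) :=
    (hK.hasMFDerivWithinAt.comp t hφ.hasFDerivWithinAt.hasMFDerivWithinAt hS).congr_of_eventuallyEq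
      h h₀
  unfold pullbackCoeff
  rw [h₁.mfderivWithin (uniqueMDiffOn_unitInterval t ht)]
  have h₂ : ((mfderivWithin 𝓘(ℝ, E) (𝓡 n) K S (φ t)).comp
      (ContinuousLinearMap.toSpanSingleton ℝ φ' : ℝ →L[ℝ] E)) (1 : ℝ) =
      mfderivWithin 𝓘(ℝ, E) (𝓡 n) K S (φ t) φ' :=
    congrArg (mfderivWithin 𝓘(ℝ, E) (𝓡 n) K S (φ t)) (one_smul ℝ φ')
  -- The fibre containing `η x` depends on `x`, so equality of base points cannot be rewritten
  -- directly. All fibres are the same model space, which allows the transport to be stated there.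
  have h₃ : ∀ (x y : X) (hxy : x = y) (v : EuclideanSpace ℝ (Fin n)),
      (η x : EuclideanSpace ℝ (Fin n) →L[ℝ] ℂ) v =
      (η y : EuclideanSpace ℝ (Fin n) →L[ℝ] ℂ) v := by
    rintro x y rfl v; rfl
  exact (congrArg (η (p (Set.projIcc 0 1 zero_le_one t)) :
    EuclideanSpace ℝ (Fin n) →L[ℝ] ℂ) h₂).trans (h₃ _ _ h₀ _)

theorem pullbackCoeff_reparam (η : OneForm n X) {p q : PathSpace n X} {φ : ℝ → ℝ} {φ' t : ℝ}
    (ht : t ∈ Set.Icc (0 : ℝ) 1) (hφ : HasDerivAt φ φ' t)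
    (hI : Set.MapsTo φ (Set.Icc 0 1) (Set.Icc 0 1))
    (h : ∀ᶠ u in nhds t, u ∈ Set.Icc (0 : ℝ) 1 → p (Set.projIcc 0 1 zero_le_one u) =
      q (Set.projIcc 0 1 zero_le_one (φ u))) :
    pullbackCoeff η p t = φ' * pullbackCoeff η q (φ t) := by
  rw [pullbackCoeff_of_eventuallyEq_comp η p ht hφ.hasDerivWithinAt hI
    ((q.contMDiffOn_projIcc _ (hI ht)).mdifferentiableWithinAt (by simp))
    (eventually_nhdsWithin_iff.2 h)]
  set L : ℝ →L[ℝ] EuclideanSpace ℝ (Fin n) := mfderivWithin 𝓘(ℝ, ℝ) (𝓡 n)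
    (fun u : ℝ => q (Set.projIcc 0 1 zero_le_one u)) (Set.Icc 0 1) (φ t) with hL
  set M : EuclideanSpace ℝ (Fin n) →L[ℝ] ℂ := η (q (Set.projIcc 0 1 zero_le_one (φ t))) with hM
  change M (L φ') = φ' * M (L 1)
  rw [← mul_one φ', ← smul_eq_mul φ' 1, map_smul, map_smul, Complex.real_smul, smul_eq_mul,
    mul_one]

end Pullback

/-! ### Smooth dependence of integrals on parameters. -/

section ParametricIntegral

/-- An integral over `[0,1]` of a smooth function depends smoothly on parameters. -/
theorem contDiff_intervalIntegral_zero_one {E : Type*} [NormedAddCommGroup E] [NormedSpace ℝ E]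
    {f : E × ℝ → ℂ} (hf : ContDiff ℝ ∞ f) :
    ContDiff ℝ ∞ fun x : E => ∫ u in (0 : ℝ)..1, f (x, u) := by
  -- With a cutoff equal to 1 on `[-1, 1]`, the integral becomes the value at 0 of the convolution
  -- of the indicator of `(0, 1]` with a smooth compactly supported kernel; evaluation at 0 explains
  -- the sign in `-u`.
  let χ : ContDiffBump (0 : ℝ) := ⟨1, 2, one_pos, one_lt_two⟩
  let g : E → ℝ → ℂ := fun x u => χ u • f (x, -u)
  have hg : ContDiff ℝ ∞ (Function.HasUncurry.uncurry g) :=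
    (χ.contDiff.comp contDiff_snd).smul (hf.comp (contDiff_fst.prodMk contDiff_snd.neg))
  let F : ℝ → ℝ := Set.indicator (Set.Ioc 0 1) 1
  have hF : MeasureTheory.LocallyIntegrable F MeasureTheory.volume :=
    ((MeasureTheory.integrable_indicator_iff measurableSet_Ioc).2
      (MeasureTheory.integrableOn_const (by simp) (by simp))).locallyIntegrable
  have h := MeasureTheory.contDiffOn_convolution_right_with_param (𝕜 := ℝ) (n := ⊤) (f := F) (g := g)
    (μ := MeasureTheory.volume)
    (ContinuousLinearMap.lsmul ℝ ℝ) (s := (Set.univ : Set E)) (k := Metric.closedBall 0 2)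
    isOpen_univ (isCompact_closedBall _ _) (fun x u _ hu => by
      have : χ u = 0 := χ.zero_of_le_dist (by
        rw [Metric.mem_closedBall, not_le] at hu
        exact hu.le)
      simp [g, this]) hF hg.contDiffOn
  rw [Set.univ_prod_univ, contDiffOn_univ] at h
  have h' := h.comp (contDiff_id.prodMk (contDiff_const (c := (0 : ℝ))))
  convert h' using 1
  funext x
  simp only [Function.comp_apply, MeasureTheory.convolution, id, zero_sub, F, g,
    ContinuousLinearMap.lsmul_apply, neg_neg]
  rw [intervalIntegral.integral_of_le zero_le_one,
    ← MeasureTheory.integral_indicator measurableSet_Ioc]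
  refine MeasureTheory.integral_congr_ae (Filter.Eventually.of_forall fun u => ?_)
  by_cases hu : u ∈ Set.Ioc (0 : ℝ) 1
  · have : χ (-u) = 1 := χ.one_of_mem_closedBall (by
      simpa [abs_le] using ⟨by linarith [hu.1], hu.2⟩)
    simp [hu, this]
  · simp [hu]

end ParametricIntegral

/-! ### Iterated integrals indexed by words, and substitution. -/

section ListIntegral

variable {n : ℕ} {X : Type*} [TopologicalSpace X] [ChartedSpace (EuclideanSpace ℝ (Fin n)) X]
  [IsManifold (𝓡 n) ∞ X]

/-- The iterated integral over `[0,t]` of a list of forms, the first form of the list being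
integrated outermost. -/
def listIntegral (p : PathSpace n X) : List (OneForm n X) → ℝ → ℂ
  | [], _ => 1
  | η :: l, t => ∫ u in (0 : ℝ)..t, listIntegral p l u * pullbackCoeff η p u

/-- The last form is integrated outermost, hence the reversal. With words as lists, the cuts in the
composition formula become `take` and `drop`. -/
theorem iteratedIntegralUpTo_eq_listIntegral (p : PathSpace n X) :
    ∀ (r : ℕ) (w : Fin r → OneForm n X) (t : ℝ),
      iteratedIntegralUpTo p r w t = listIntegral p (List.ofFn w).reverse t
  | 0, _, _ => by simp [iteratedIntegralUpTo, listIntegral]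
  | r + 1, w, t => by
      rw [List.ofFn_succ', List.concat_eq_append, List.reverse_append]
      simp only [iteratedIntegralUpTo, List.reverse_singleton, List.singleton_append, listIntegral]
      refine intervalIntegral.integral_congr fun u _ => ?_
      simp only [iteratedIntegralUpTo_eq_listIntegral p r]
      rfl

theorem continuousOn_listIntegral (p : PathSpace n X) (l : List (OneForm n X)) :
    ContinuousOn (listIntegral p l) (Set.Icc 0 1) := by
  induction l with
  | nil => exact continuousOn_const
  | cons η l ih =>
    have h : ContinuousOn (fun u => listIntegral p l u * pullbackCoeff η p u) (Set.Icc 0 1) :=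
      ih.mul (continuousOn_pullbackCoeff η p)
    have h' := intervalIntegral.continuousOn_primitive_interval (a := 0) (b := 1)
      (μ := MeasureTheory.volume)
      (f := fun u => listIntegral p l u * pullbackCoeff η p u) (by
        rw [Set.uIcc_of_le zero_le_one]
        exact h.integrableOn_compact isCompact_Icc)
    rwa [Set.uIcc_of_le zero_le_one] at h'

/-- Integration by substitution along a reparametrization `φ` of part of a path. -/
theorem integral_mul_pullbackCoeff_reparam (η : OneForm n X) {p q : PathSpace n X} {φ : ℝ → ℝ}
    {a b : ℝ} (hφ : ContDiff ℝ ∞ φ)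
    (hI : Set.MapsTo φ (Set.Icc 0 1) (Set.Icc 0 1)) (ha : a ∈ Set.Icc (0 : ℝ) 1)
    (hb : b ∈ Set.Icc (0 : ℝ) 1)
    (h : ∀ t ∈ Set.uIcc a b, ∀ᶠ u in nhds t, u ∈ Set.Icc (0 : ℝ) 1 →
      p (Set.projIcc 0 1 zero_le_one u) = q (Set.projIcc 0 1 zero_le_one (φ u)))
    {f : ℝ → ℂ} (hf : ContinuousOn f (Set.Icc 0 1)) :
    ∫ u in a..b, f (φ u) * pullbackCoeff η p u =
      ∫ u in φ a..φ b, f u * pullbackCoeff η q u := by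
  have hab : Set.uIcc a b ⊆ Set.Icc (0 : ℝ) 1 := Set.uIcc_subset_Icc ha hb
  have hd : ∀ x, HasDerivAt φ (deriv φ x) x := fun x =>
    (hφ.differentiable (by simp)).differentiableAt.hasDerivAt
  rw [← intervalIntegral.integral_deriv_smul_comp' (f' := deriv φ)
    (g := fun u => f u * pullbackCoeff η q u) (fun x _ => hd x)
    (hφ.continuous_deriv (by simp)).continuousOn
    ((hf.mul (continuousOn_pullbackCoeff η q)).mono
      ((Set.image_mono hab).trans hI.image_subset))]
  refine intervalIntegral.integral_congr fun u hu => ?_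
  simp only [Function.comp_apply, pullbackCoeff_reparam η (hab hu) (hd u) hI (h u hu),
    Complex.real_smul]
  ring

end ListIntegral

/-! ### Smooth concatenation and the composition formula. -/

section Concat

/-- The reparametrization used for the first half of a concatenation. -/
def firstHalf (t : ℝ) : ℝ := Real.smoothTransition (4 * t)

/-- The reparametrization used for the second half of a concatenation. -/
def secondHalf (t : ℝ) : ℝ := Real.smoothTransition (4 * t - 3)

theorem contDiff_firstHalf : ContDiff ℝ ∞ firstHalf :=
  Real.smoothTransition.contDiff.comp (contDiff_const.mul contDiff_id)

theorem contDiff_secondHalf : ContDiff ℝ ∞ secondHalf :=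
  Real.smoothTransition.contDiff.comp ((contDiff_const.mul contDiff_id).sub contDiff_const)

theorem firstHalf_mem (t : ℝ) : firstHalf t ∈ Set.Icc (0 : ℝ) 1 :=
  ⟨Real.smoothTransition.nonneg _, Real.smoothTransition.le_one _⟩

theorem secondHalf_mem (t : ℝ) : secondHalf t ∈ Set.Icc (0 : ℝ) 1 :=
  ⟨Real.smoothTransition.nonneg _, Real.smoothTransition.le_one _⟩

theorem firstHalf_zero : firstHalf 0 = 0 := by simp [firstHalf]

theorem firstHalf_of_le {t : ℝ} (ht : 1 / 4 ≤ t) : firstHalf t = 1 :=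
  Real.smoothTransition.one_of_one_le (by linarith)

theorem secondHalf_of_le {t : ℝ} (ht : t ≤ 3 / 4) : secondHalf t = 0 :=
  Real.smoothTransition.zero_of_nonpos (by linarith)

theorem secondHalf_one : secondHalf 1 = 1 :=
  Real.smoothTransition.one_of_one_le (by norm_num)

variable {n : ℕ} {X : Type*} [TopologicalSpace X] [ChartedSpace (EuclideanSpace ℝ (Fin n)) X]

/-- The concatenation of two smooth paths as a function on `ℝ`, constant around `1/2`. -/
def concatFun (p q : PathSpace n X) (t : ℝ) : X :=
  if t < 1 / 2 then p (Set.projIcc 0 1 zero_le_one (firstHalf t))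
  else q (Set.projIcc 0 1 zero_le_one (secondHalf t))

variable {p q : PathSpace n X}

/-- Both reparametrizations are constant on `[1/4, 3/4]`, where both branches give the common point
`p 1 = q 0`. Each formula is therefore valid on an open set reaching past `1/2`, which yields
smoothness and derivatives at the junction without any matching of jets. -/
theorem concatFun_of_lt (h : p 1 = q 0) {t : ℝ} (ht : t < 3 / 4) :
    concatFun p q t = p (Set.projIcc 0 1 zero_le_one (firstHalf t)) := by
  unfold concatFun
  split_ifs with h'
  · rfl
  · rw [secondHalf_of_le ht.le, firstHalf_of_le (by linarith), Set.projIcc_left, Set.projIcc_right]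
    exact h.symm

theorem concatFun_of_gt (h : p 1 = q 0) {t : ℝ} (ht : 1 / 4 < t) :
    concatFun p q t = q (Set.projIcc 0 1 zero_le_one (secondHalf t)) := by
  unfold concatFun
  split_ifs with h'
  · rw [secondHalf_of_le (by linarith), firstHalf_of_le ht.le, Set.projIcc_left, Set.projIcc_right]
    exact h
  · rfl

theorem PathSpace.contMDiff_comp_projIcc (p : PathSpace n X) {φ : ℝ → ℝ} (hφ : ContDiff ℝ ∞ φ)
    (hI : ∀ t, φ t ∈ Set.Icc (0 : ℝ) 1) :
    ContMDiff 𝓘(ℝ, ℝ) (𝓡 n) ∞ fun t => p (Set.projIcc 0 1 zero_le_one (φ t)) :=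
  p.contMDiffOn_projIcc.comp_contMDiff hφ.contMDiff hI

theorem contMDiff_concatFun (h : p 1 = q 0) : ContMDiff 𝓘(ℝ, ℝ) (𝓡 n) ∞ (concatFun p q) := by
  intro t
  rcases lt_or_ge t (3 / 4) with ht | ht
  · refine (p.contMDiff_comp_projIcc contDiff_firstHalf firstHalf_mem t).congr_of_eventuallyEq ?_
    filter_upwards [Iio_mem_nhds ht] with u hu using concatFun_of_lt h hu
  · refine (q.contMDiff_comp_projIcc contDiff_secondHalf secondHalf_mem t).congr_of_eventuallyEq ?_
    filter_upwards [Ioi_mem_nhds (show (1 / 4 : ℝ) < t by linarith)] with u hu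
      using concatFun_of_gt h hu

/-- The concatenation of two smooth paths, smoothed around the middle. -/
def concat (p q : PathSpace n X) (h : p 1 = q 0) : PathSpace n X :=
  ⟨fun t => concatFun p q t, (contMDiff_concatFun h).comp contMDiff_subtypeVal_Icc⟩

theorem concat_apply (h : p 1 = q 0) (t : unitInterval) : concat p q h t = concatFun p q t := rfl

theorem concat_projIcc (h : p 1 = q 0) {t : ℝ} (ht : t ∈ Set.Icc (0 : ℝ) 1) :
    concat p q h (Set.projIcc 0 1 zero_le_one t) = concatFun p q t := by
  rw [concat_apply, Set.projIcc_of_mem _ ht]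

theorem concat_zero (h : p 1 = q 0) : concat p q h 0 = p 0 := by
  rw [concat_apply, concatFun_of_lt h (by norm_num)]
  simp [firstHalf_zero]

theorem concat_one (h : p 1 = q 0) : concat p q h 1 = q 1 := by
  rw [concat_apply, concatFun_of_gt h (by norm_num)]
  simp [secondHalf_one]

variable [IsManifold (𝓡 n) ∞ X]

theorem listIntegral_concat_firstHalf (h : p 1 = q 0) (l : List (OneForm n X)) {t : ℝ}
    (ht : t ∈ Set.Icc (0 : ℝ) (1 / 2)) :
    listIntegral (concat p q h) l t = listIntegral p l (firstHalf t) := by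
  induction l generalizing t with
  | nil => rfl
  | cons η l ih =>
    have hc : Set.uIcc 0 t = Set.Icc 0 t := Set.uIcc_of_le ht.1
    have key := integral_mul_pullbackCoeff_reparam η (p := concat p q h) (q := p)
      (φ := firstHalf) (a := 0) (b := t) contDiff_firstHalf (fun t _ => firstHalf_mem t)
      (by simp) ⟨ht.1, by linarith [ht.2]⟩ (fun u hu => by
        rw [hc] at hu
        filter_upwards [Iio_mem_nhds (show u < 3 / 4 by linarith [hu.2, ht.2])] with v hv hv'
        rw [concat_projIcc h hv', concatFun_of_lt h hv]) (continuousOn_listIntegral p l)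
    rw [firstHalf_zero] at key
    simp only [listIntegral]
    rw [← key]
    refine intervalIntegral.integral_congr fun u hu => ?_
    rw [hc] at hu
    simp only [ih ⟨hu.1, hu.2.trans ht.2⟩]

/-- Split the outermost integral at `1/2`. Up to `1/2` the whole word is integrated along `p`, which
is the term `i = 0`; beyond it, the outermost form lies on `q`, and induction on the remaining word
gives the terms `i + 1`. The inner forms `drop i` fall on `p`, the outer forms `take i` on `q`. -/
theorem listIntegral_concat_secondHalf (h : p 1 = q 0) (l : List (OneForm n X)) {t : ℝ}
    (ht : t ∈ Set.Icc (1 / 2 : ℝ) 1) :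
    listIntegral (concat p q h) l t = ∑ i ∈ Finset.range (l.length + 1),
      listIntegral p (l.drop i) 1 * listIntegral q (l.take i) (secondHalf t) := by
  induction l generalizing t with
  | nil => simp [listIntegral]
  | cons η l ih =>
    have hc : Set.uIcc (1 / 2) t = Set.Icc (1 / 2) t := Set.uIcc_of_le ht.1
    have hq (i : ℕ) : ContinuousOn (fun u => listIntegral q (l.take i) u * pullbackCoeff η q u)
        (Set.Icc 0 1) :=
      (continuousOn_listIntegral q _).mul (continuousOn_pullbackCoeff η q)
    have key := integral_mul_pullbackCoeff_reparam η (p := concat p q h) (q := q)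
      (φ := secondHalf) (a := 1 / 2) (b := t) contDiff_secondHalf (fun t _ => secondHalf_mem t)
      (by norm_num) ⟨by linarith [ht.1], ht.2⟩ (fun u hu => by
        rw [hc] at hu
        filter_upwards [Ioi_mem_nhds (show 1 / 4 < u by linarith [hu.1])] with v hv hv'
        rw [concat_projIcc h hv', concatFun_of_gt h hv])
      (f := fun v => ∑ i ∈ Finset.range (l.length + 1),
        listIntegral p (l.drop i) 1 * listIntegral q (l.take i) v)
      (continuousOn_finsetSum _ fun i _ =>
        continuousOn_const.mul (continuousOn_listIntegral q _))
    rw [secondHalf_of_le (by norm_num)] at key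
    have hint : ContinuousOn (fun u => listIntegral (concat p q h) l u *
        pullbackCoeff η (concat p q h) u) (Set.Icc 0 1) :=
      (continuousOn_listIntegral _ _).mul (continuousOn_pullbackCoeff η _)
    have hii {a b : ℝ} (ha : a ∈ Set.Icc (0 : ℝ) 1) (hb : b ∈ Set.Icc (0 : ℝ) 1) :
        IntervalIntegrable (fun u => listIntegral (concat p q h) l u *
        pullbackCoeff η (concat p q h) u) MeasureTheory.volume a b :=
      (hint.mono (Set.uIcc_subset_Icc ha hb)).intervalIntegrable
    have h₁ : ∫ u in (0 : ℝ)..1 / 2, listIntegral (concat p q h) l u *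
        pullbackCoeff η (concat p q h) u = listIntegral p (η :: l) 1 := by
      have := listIntegral_concat_firstHalf h (η :: l) (t := 1 / 2) (by norm_num)
      rwa [firstHalf_of_le (by norm_num)] at this
    have h₂ : ∫ u in (1 / 2 : ℝ)..t, listIntegral (concat p q h) l u *
        pullbackCoeff η (concat p q h) u = ∑ i ∈ Finset.range (l.length + 1),
          listIntegral p (l.drop i) 1 * listIntegral q (η :: l.take i) (secondHalf t) := by
      rw [intervalIntegral.integral_congr (g := fun u => (∑ i ∈ Finset.range (l.length + 1),
        listIntegral p (l.drop i) 1 * listIntegral q (l.take i) (secondHalf u)) *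
          pullbackCoeff η (concat p q h) u), key]
      · simp only [Finset.sum_mul, mul_assoc]
        rw [intervalIntegral.integral_finsetSum]
        · simp only [intervalIntegral.integral_const_mul, listIntegral]
        · intro i _
          exact (((hq i).mono (Set.uIcc_subset_Icc (by simp)
            (secondHalf_mem t))).intervalIntegrable).const_mul _
      · intro u hu
        rw [hc] at hu
        simp only [ih ⟨hu.1, hu.2.trans ht.2⟩]
    rw [List.length_cons, Finset.sum_range_succ']
    simp only [List.drop_succ_cons, List.take_succ_cons, List.drop_zero, List.take_zero]
    rw [← h₂, listIntegral.eq_2 (concat p q h),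
      ← intervalIntegral.integral_add_adjacent_intervals (b := 1 / 2)
      (hii (by norm_num) (by norm_num)) (hii (by norm_num) ⟨by linarith [ht.1], ht.2⟩), h₁]
    simp only [listIntegral, mul_one]
    ring

/-- The composition formula for iterated integrals. -/
theorem listIntegral_concat (h : p 1 = q 0) (l : List (OneForm n X)) :
    listIntegral (concat p q h) l 1 = ∑ i ∈ Finset.range (l.length + 1),
      listIntegral p (l.drop i) 1 * listIntegral q (l.take i) 1 := by
  rw [listIntegral_concat_secondHalf h l (by norm_num), secondHalf_one]

end Concat

/-! ### Radial paths, smooth path-connectedness and radial integrals. -/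

section Parametrization

variable {n : ℕ} {X : Type*} [TopologicalSpace X] [ChartedSpace (EuclideanSpace ℝ (Fin n)) X]

/-- Every point of a manifold has a neighbourhood parametrized by the whole model space. -/
theorem exists_smooth_parametrization [IsManifold (𝓡 n) ∞ X] (x : X) :
    ∃ (K : EuclideanSpace ℝ (Fin n) → X) (κ : X → EuclideanSpace ℝ (Fin n)),
      ContMDiff (𝓡 n) (𝓡 n) ∞ K ∧ K 0 = x ∧ ContMDiffAt (𝓡 n) (𝓡 n) ∞ κ x ∧
        ∀ᶠ y in nhds x, K (κ y) = y := by
  obtain ⟨ε, hε, hball⟩ := Metric.isOpen_iff.1 (isOpen_extChartAt_target (I := 𝓡 n) x)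
    (extChartAt (𝓡 n) x x) (mem_extChartAt_target x)
  set c := extChartAt (𝓡 n) x x with hc
  -- A diffeomorphism of the whole model space onto a ball inside the chart target, with 0 going to
  -- the centre: every segment from 0 then has an image in the manifold.
  let B := OpenPartialHomeomorph.univBall c ε
  have hBs : B.source = Set.univ := OpenPartialHomeomorph.univBall_source c ε
  have hBt : B.target = Metric.ball c ε := OpenPartialHomeomorph.univBall_target c hε
  have hB (v) : B v ∈ Metric.ball c ε := hBt ▸ B.map_source (hBs ▸ Set.mem_univ v)
  refine ⟨fun v => (extChartAt (𝓡 n) x).symm (B v), fun y => B.symm (extChartAt (𝓡 n) x y),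
    ?_, ?_, ?_, ?_⟩
  · exact (contMDiffOn_extChartAt_symm x).comp_contMDiff
      (OpenPartialHomeomorph.contDiff_univBall (n := ⊤)).contMDiff fun v => hball (hB v)
  · change (extChartAt (𝓡 n) x).symm (OpenPartialHomeomorph.univBall c ε 0) = x
    rw [OpenPartialHomeomorph.univBall_apply_zero, hc, extChartAt_to_inv]
  · have h : ContDiffAt ℝ ∞ B.symm c :=
      (OpenPartialHomeomorph.contDiffOn_univBall_symm (n := ⊤)).contDiffAt
        (Metric.ball_mem_nhds c hε)
    exact ContMDiffAt.comp x h.contMDiffAt contMDiffAt_extChartAt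
  · filter_upwards [extChartAt_source_mem_nhds (I := 𝓡 n) x,
      (continuousAt_extChartAt (I := 𝓡 n) x).preimage_mem_nhds (Metric.ball_mem_nhds c hε)]
      with y hy hy'
    rw [B.right_inv (hBt ▸ hy'), (extChartAt (𝓡 n) x).left_inv hy]

/-- The image under `K` of the segment from `0` to `v`. -/
def radialPath {K : EuclideanSpace ℝ (Fin n) → X} (hK : ContMDiff (𝓡 n) (𝓡 n) ∞ K)
    (v : EuclideanSpace ℝ (Fin n)) : PathSpace n X :=
  ⟨fun t => K ((t : ℝ) • v), (hK.comp (contDiff_id.smul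
    (contDiff_const (c := v))).contMDiff).comp contMDiff_subtypeVal_Icc⟩

theorem radialPath_apply {K : EuclideanSpace ℝ (Fin n) → X} (hK : ContMDiff (𝓡 n) (𝓡 n) ∞ K)
    (v : EuclideanSpace ℝ (Fin n)) (t : unitInterval) :
    radialPath hK v t = K ((t : ℝ) • v) := rfl

theorem radialPath_zero {K : EuclideanSpace ℝ (Fin n) → X} (hK : ContMDiff (𝓡 n) (𝓡 n) ∞ K)
    (v : EuclideanSpace ℝ (Fin n)) : radialPath hK v 0 = K 0 := by
  simp [radialPath_apply]

theorem radialPath_one {K : EuclideanSpace ℝ (Fin n) → X} (hK : ContMDiff (𝓡 n) (𝓡 n) ∞ K)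
    (v : EuclideanSpace ℝ (Fin n)) : radialPath hK v 1 = K v := by
  simp [radialPath_apply]

/-- The reverse of a smooth path. -/
def reversePath (p : PathSpace n X) : PathSpace n X :=
  ⟨fun t => p (Set.projIcc 0 1 zero_le_one (Real.smoothTransition (1 - t))),
    (p.contMDiff_comp_projIcc (φ := fun t => Real.smoothTransition (1 - t))
      (Real.smoothTransition.contDiff.comp (contDiff_const.sub contDiff_id))
      fun _ => ⟨Real.smoothTransition.nonneg _, Real.smoothTransition.le_one _⟩).comp
      contMDiff_subtypeVal_Icc⟩

theorem reversePath_apply (p : PathSpace n X) (t : unitInterval) :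
    reversePath p t =
      p (Set.projIcc 0 1 zero_le_one (Real.smoothTransition (1 - (t : ℝ)))) := rfl

/-- Being joined by a smooth path is symmetric by reversal and transitive by concatenation, and
radial paths join a point to all nearby ones; preconnectedness does the rest. -/
theorem exists_path [IsManifold (𝓡 n) ∞ X] [PreconnectedSpace X] (x y : X) :
    ∃ p : PathSpace n X, p 0 = x ∧ p 1 = y := by
  let P : X → X → Prop := fun x y => ∃ p : PathSpace n X, p 0 = x ∧ p 1 = y
  have hs : Std.Symm P := ⟨fun x y ⟨p, h₀, h₁⟩ => ⟨reversePath p, by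
    simpa [reversePath_apply] using h₁, by simpa [reversePath_apply] using h₀⟩⟩
  refine PreconnectedSpace.induction₂ P (fun x => ?_) ⟨fun x y z => ?_⟩ x y
  · obtain ⟨K, κ, hK, h₀, -, h⟩ := exists_smooth_parametrization (n := n) x
    filter_upwards [h] with y hy
    exact ⟨radialPath hK (κ y), (radialPath_zero hK _).trans h₀, (radialPath_one hK _).trans hy⟩
  · rintro ⟨p, hp₀, hp₁⟩ ⟨q, hq₀, hq₁⟩
    have h : p 1 = q 0 := hp₁.trans hq₀.symm
    exact ⟨concat p q h, (concat_zero h).trans hp₀, (concat_one h).trans hq₁⟩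

variable [IsManifold (𝓡 n) ∞ X]

/-- The iterated integral along the radial path with end point `K v`. -/
def radialIntegral (K : EuclideanSpace ℝ (Fin n) → X) :
    List (OneForm n X) → EuclideanSpace ℝ (Fin n) → ℂ
  | [], _ => 1
  | η :: l, v => ∫ u in (0 : ℝ)..1, radialIntegral K l (u • v) *
      η (K (u • v)) (mfderivWithin (𝓡 n) (𝓡 n) K Set.univ (u • v) v)

/-- Each step is an integral over the fixed interval `[0, 1]` with `v` only a parameter of a smooth
integrand. -/
theorem contDiff_radialIntegral {K : EuclideanSpace ℝ (Fin n) → X}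
    (hK : ContMDiff (𝓡 n) (𝓡 n) ∞ K) (l : List (OneForm n X)) :
    ContDiff ℝ ∞ (radialIntegral K l) := by
  induction l with
  | nil => exact contDiff_const
  | cons η l ih =>
    let G : EuclideanSpace ℝ (Fin n) → (EuclideanSpace ℝ (Fin n) →L[ℝ] ℂ) := fun x =>
      (η (K x) : EuclideanSpace ℝ (Fin n) →L[ℝ] ℂ).comp
        (mfderivWithin (𝓡 n) (𝓡 n) K Set.univ x :
          EuclideanSpace ℝ (Fin n) →L[ℝ] EuclideanSpace ℝ (Fin n))
    have hG : ContDiff ℝ ∞ G := contDiff_clm_apply_iff.2 fun v => contDiffOn_univ.1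
      (contDiffOn_oneForm_mfderivWithin η hK.contMDiffOn uniqueMDiffOn_univ v)
    have hs : ContDiff ℝ ∞ fun z : EuclideanSpace ℝ (Fin n) × ℝ => z.2 • z.1 :=
      contDiff_snd.smul contDiff_fst
    exact contDiff_intervalIntegral_zero_one
      (f := fun z => radialIntegral K l (z.2 • z.1) * G (z.2 • z.1) z.1)
      ((ih.comp hs).mul ((hG.comp hs).clm_apply contDiff_fst))

/-- The part over `[0, t]` of the segment to `v` is a rescaling of the segment to `t • v`, and the
form absorbs the factor `t` by linearity. -/
theorem listIntegral_radialPath {K : EuclideanSpace ℝ (Fin n) → X}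
    (hK : ContMDiff (𝓡 n) (𝓡 n) ∞ K) (v : EuclideanSpace ℝ (Fin n)) (l : List (OneForm n X))
    {t : ℝ} (ht : t ∈ Set.Icc (0 : ℝ) 1) :
    listIntegral (radialPath hK v) l t = radialIntegral K l (t • v) := by
  induction l generalizing t with
  | nil => rfl
  | cons η l ih =>
    let G : EuclideanSpace ℝ (Fin n) → (EuclideanSpace ℝ (Fin n) →L[ℝ] ℂ) := fun x =>
      (η (K x) : EuclideanSpace ℝ (Fin n) →L[ℝ] ℂ).comp
        (mfderivWithin (𝓡 n) (𝓡 n) K Set.univ x :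
          EuclideanSpace ℝ (Fin n) →L[ℝ] EuclideanSpace ℝ (Fin n))
    have h₁ : ∀ u ∈ Set.uIcc 0 t, listIntegral (radialPath hK v) l u *
        pullbackCoeff η (radialPath hK v) u = radialIntegral K l (u • v) * G (u • v) v := by
      intro u hu
      have hu' : u ∈ Set.Icc (0 : ℝ) 1 :=
        Set.uIcc_subset_Icc (by simp) ht hu
      have hd : HasDerivWithinAt (fun u : ℝ => u • v) v (Set.Icc 0 1) u := by
        simpa using ((hasDerivAt_id u).smul_const v).hasDerivWithinAt
      rw [ih hu', pullbackCoeff_of_eventuallyEq_comp η (radialPath hK v) (K := K) (S := Set.univ)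
        hu' hd (Set.mapsTo_univ _ _)
        ((hK.mdifferentiable (by simp)).mdifferentiableAt.mdifferentiableWithinAt)]
      · rfl
      · filter_upwards [self_mem_nhdsWithin] with w hw
        rw [radialPath_apply, Set.projIcc_of_mem _ hw]
        rfl
    -- The substitution in this form involves no division by `t`, so `t = 0` needs no separate case.
    have h₂ := intervalIntegral.smul_integral_comp_mul_left (a := 0) (b := 1)
      (fun u => radialIntegral K l (u • v) * G (u • v) v) t
    rw [mul_zero, mul_one] at h₂
    rw [listIntegral, intervalIntegral.integral_congr h₁, ← h₂,
      ← intervalIntegral.integral_smul]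
    refine intervalIntegral.integral_congr fun u _ => ?_
    change t • (radialIntegral K l ((t * u) • v) * G ((t * u) • v) v) =
      radialIntegral K l (u • t • v) * G (u • t • v) (t • v)
    rw [smul_smul, map_smul, mul_comm t u, mul_smul_comm]

end Parametrization

/-! ### The length filtration on iterated integrals. -/

section Lengths

variable {n : ℕ} {X : Type*} [TopologicalSpace X] [ChartedSpace (EuclideanSpace ℝ (Fin n)) X]
  [IsManifold (𝓡 n) ∞ X]

variable (n X) in
/-- The linear combinations of iterated integrals of length less than `k`. -/
def iteratedIntegralsLT (k : ℕ) : Submodule ℂ (PathSpace n X → ℂ) :=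
  Submodule.span ℂ {F | ∃ l : List (OneForm n X), l.length < k ∧ F = fun p => listIntegral p l 1}

/-- The strict bound shifts the index by one, so that the filtration starts with the zero space;
this is the source of the order `s + 1`. -/
theorem iteratedIntegrals_le (s : ℕ) :
    iteratedIntegrals n X s ≤ iteratedIntegralsLT n X (s + 1) := by
  refine Submodule.span_le.2 ?_
  rintro F ⟨r, hr, w, rfl⟩
  refine Submodule.subset_span ⟨(List.ofFn w).reverse, ?_, ?_⟩
  · simpa using Nat.lt_succ_of_le hr
  · funext p
    exact iteratedIntegralUpTo_eq_listIntegral p r w 1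

theorem iteratedIntegralsLT_mono : Monotone (iteratedIntegralsLT n X) := fun _ _ h =>
  Submodule.span_mono fun _ ⟨l, hl, hF⟩ => ⟨l, hl.trans_le h, hF⟩

theorem eq_zero_of_mem_iteratedIntegralsLT_zero {F : PathSpace n X → ℂ}
    (hF : F ∈ iteratedIntegralsLT n X 0) : F = 0 := by
  simpa [iteratedIntegralsLT] using hF

/-- Translation by a path changes an iterated integral by shorter iterated integrals. -/
theorem exists_concat_eq_add {k : ℕ} {F : PathSpace n X → ℂ}
    (hF : F ∈ iteratedIntegralsLT n X (k + 1)) (p : PathSpace n X) :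
    ∃ G ∈ iteratedIntegralsLT n X k, ∀ (q : PathSpace n X) (h : p 1 = q 0),
      F (concat p q h) = F q + G q := by
  induction hF using Submodule.span_induction with
  | mem F hF =>
    obtain ⟨l, hl, rfl⟩ := hF
    -- The omitted term `i = l.length` of the composition formula puts the whole word on `q` and the
    -- empty word, with integral 1, on `p`; it is `F q` itself.
    refine ⟨∑ i ∈ Finset.range l.length, listIntegral p (l.drop i) 1 •
      fun q => listIntegral q (l.take i) 1, ?_, fun q h => ?_⟩
    · refine Submodule.sum_mem _ fun i hi => Submodule.smul_mem _ _ (Submodule.subset_span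
        ⟨l.take i, ?_, rfl⟩)
      have := Finset.mem_range.1 hi
      rw [List.length_take]
      omega
    · simp only [listIntegral_concat h, Finset.sum_range_succ, List.drop_length, List.take_length,
        Finset.sum_apply, Pi.smul_apply, smul_eq_mul]
      simp only [listIntegral, one_mul]
      ring
  | zero => exact ⟨0, Submodule.zero_mem _, fun q h => by simp⟩
  | add F F' _ _ hF hF' =>
    obtain ⟨G, hG, h⟩ := hF
    obtain ⟨G', hG', h'⟩ := hF'
    refine ⟨G + G', Submodule.add_mem _ hG hG', fun q hq => ?_⟩
    simp only [Pi.add_apply, h q hq, h' q hq]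
    ring
  | smul c F _ hF =>
    obtain ⟨G, hG, h⟩ := hF
    refine ⟨c • G, Submodule.smul_mem _ c hG, fun q hq => ?_⟩
    simp only [Pi.smul_apply, h q hq, smul_add]

/-- In the composition formula the fixed path `p` contributes only constants, and the radial path
contributes smooth functions of `v`. -/
theorem exists_contDiff_concat_radialPath {k : ℕ} {F : PathSpace n X → ℂ}
    (hF : F ∈ iteratedIntegralsLT n X k) (p : PathSpace n X)
    {K : EuclideanSpace ℝ (Fin n) → X} (hK : ContMDiff (𝓡 n) (𝓡 n) ∞ K) :
    ∃ A : EuclideanSpace ℝ (Fin n) → ℂ, ContDiff ℝ ∞ A ∧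
      ∀ v (h : p 1 = radialPath hK v 0), F (concat p (radialPath hK v) h) = A v := by
  induction hF using Submodule.span_induction with
  | mem F hF =>
    obtain ⟨l, hl, rfl⟩ := hF
    refine ⟨fun v => ∑ i ∈ Finset.range (l.length + 1), listIntegral p (l.drop i) 1 *
      radialIntegral K (l.take i) v, ContDiff.sum fun i _ =>
        contDiff_const.mul (contDiff_radialIntegral hK _), fun v h => ?_⟩
    simp only [listIntegral_concat h,
      listIntegral_radialPath hK v _ (Set.right_mem_Icc.2 zero_le_one), one_smul]
  | zero => exact ⟨0, contDiff_const, fun v h => rfl⟩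
  | add F F' _ _ hF hF' =>
    obtain ⟨A, hA, h⟩ := hF
    obtain ⟨A', hA', h'⟩ := hF'
    exact ⟨A + A', hA.add hA', fun v hv => by simp only [Pi.add_apply, h v hv, h' v hv]⟩
  | smul c F _ hF =>
    obtain ⟨A, hA, h⟩ := hF
    exact ⟨c • A, contDiff_const.smul hA, fun v hv => by simp only [Pi.smul_apply, h v hv]⟩

end Lengths

/-! ### Powers of the augmentation ideal acting on a filtration. -/

section GroupRing

variable {Γ V : Type*} [Group Γ] [AddCommGroup V] [Module ℂ V] (ρ : Representation ℂ Γ V)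

theorem lift_mem_of_forall_mem {W : Submodule ℂ V} (hW : ∀ γ, ∀ v ∈ W, ρ γ v ∈ W)
    (a : MonoidAlgebra ℤ Γ) {v : V} (hv : v ∈ W) :
    MonoidAlgebra.lift ℤ (Module.End ℂ V) Γ ρ a v ∈ W := by
  induction a using MonoidAlgebra.induction_on with
  | of γ => simpa using hW γ v hv
  | add a b ha hb => simpa using W.add_mem ha hb
  | smul c a ha => simpa using zsmul_mem ha c

/-- If each `γ - 1` lowers a filtration by one step, then the `m`-th power of the augmentation
ideal lowers it by `m` steps. -/
theorem lift_mem_of_mem_augmentationIdeal_pow {W : ℕ → Submodule ℂ V}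
    (hW : ∀ k γ, ∀ v ∈ W k, ρ γ v ∈ W k) (hW' : ∀ k γ, ∀ v ∈ W (k + 1), ρ γ v - v ∈ W k)
    (m k : ℕ) {j : MonoidAlgebra ℤ Γ} (hj : j ∈ augmentationIdeal Γ ^ m) {v : V}
    (hv : v ∈ W (k + m)) : MonoidAlgebra.lift ℤ (Module.End ℂ V) Γ ρ j v ∈ W k := by
  induction m generalizing j v with
  | zero => exact lift_mem_of_forall_mem ρ (hW k) j hv
  | succ m ih =>
    have h₁ : ∀ b ∈ augmentationIdeal Γ, ∀ v ∈ W (k + (m + 1)),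
        MonoidAlgebra.lift ℤ (Module.End ℂ V) Γ ρ b v ∈ W (k + m) := by
      intro b hb v hv
      induction hb using Submodule.span_induction with
      | mem b hb =>
        obtain ⟨γ, rfl⟩ := hb
        simpa using hW' (k + m) γ v hv
      | zero => simp
      | add a b _ _ ha hb => simpa using Submodule.add_mem _ ha hb
      | smul a b _ hb =>
        -- In `a * b` the factor `b` acts first and lowers the filtration; `a` then preserves the
        -- step reached.
        rw [smul_eq_mul, map_mul]
        exact lift_mem_of_forall_mem ρ (hW (k + m)) a hb
    -- Peel off the right factor: it acts first, lowering `k + (m + 1)` to `k + m`, and the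
    -- induction hypothesis handles the remaining `m` factors.
    rw [Submodule.pow_succ] at hj
    induction hj using Submodule.mul_induction_on' with
    | mem_mul_mem a ha b hb =>
      rw [map_mul]
      exact ih ha (h₁ b hb v hv)
    | add a _ b _ ha hb => simpa using Submodule.add_mem _ ha hb

end GroupRing

/-! ### Primitives on the universal covering and the deck action. -/

namespace IsSmoothUniversalCovering

variable {n : ℕ} {X Y : Type*} [TopologicalSpace X]
    [ChartedSpace (EuclideanSpace ℝ (Fin n)) X] [TopologicalSpace Y]
    [ChartedSpace (EuclideanSpace ℝ (Fin n)) Y] {π : Y → X}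
    (hπ : IsSmoothUniversalCovering n π) {x₀ : X} (e : π ⁻¹' {x₀})

/-- The image of a smooth path in the covering space. -/
def mapPath (p : PathSpace n Y) : PathSpace n X := ContMDiffMap.comp ⟨π, hπ.contMDiff⟩ p

theorem mapPath_concat {p q : PathSpace n Y} (h : p 1 = q 0) :
    hπ.mapPath (concat p q h) = concat (hπ.mapPath p) (hπ.mapPath q) (congrArg π h) := by
  refine ContMDiffMap.ext fun t => ?_
  change π (concatFun p q t) = concatFun (hπ.mapPath p) (hπ.mapPath q) t
  unfold concatFun
  split_ifs <;> rfl

/-- The image of a smooth path under a deck transformation. -/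
def deckPath (γ : FundamentalGroup X x₀) (p : PathSpace n Y) : PathSpace n Y :=
  ContMDiffMap.comp ⟨hπ.deck e γ, hπ.contMDiff_deck e γ⟩ p

theorem deckPath_apply (γ : FundamentalGroup X x₀) (p : PathSpace n Y) (t : unitInterval) :
    hπ.deckPath e γ p t = hπ.deck e γ (p t) := rfl

theorem mapPath_deckPath (γ : FundamentalGroup X x₀) (p : PathSpace n Y) :
    hπ.mapPath (hπ.deckPath e γ p) = hπ.mapPath p :=
  ContMDiffMap.ext fun t => congrFun (hπ.comp_deck e γ) (p t)

/-- Smooth paths lift to smooth paths. -/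
theorem exists_projPath_eq (q : PathSpaceFrom n x₀) :
    ∃ p : PathSpaceFrom n (e : Y), hπ.projPath e p = q := by
  have h₀ : (q.1 : C(unitInterval, X)) 0 = π (e : Y) := q.2.trans e.2.symm
  let L := hπ.isCoveringMap.liftPath (q.1 : C(unitInterval, X)) e h₀
  have hL : ∀ t, π (L t) = q.1 t := congrFun (hπ.isCoveringMap.liftPath_lifts _ _ h₀)
  have hs : ContMDiff (𝓡∂ 1) (𝓡 n) ∞ L := by
    intro t
    have ht := hπ.isLocalDiffeomorph (L t)
    -- The continuous lift agrees near `t` with a smooth local inverse of `π` composed with `q`.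
    have h : ContMDiffAt (𝓡∂ 1) (𝓡 n) ∞ (ht.localInverse ∘ q.1) t := by
      refine ContMDiffAt.comp t ?_ (q.1.contMDiff t)
      rw [← hL t]
      exact ht.localInverse_contMDiffAt
    refine h.congr_of_eventuallyEq ?_
    filter_upwards [L.continuous.continuousAt.eventually ht.localInverse_eventuallyEq_left]
      with u hu
    exact hu.symm.trans (congrArg ht.localInverse (hL u))
  exact ⟨⟨⟨L, hs⟩, hπ.isCoveringMap.liftPath_zero _ _ h₀⟩,
    Subtype.ext (ContMDiffMap.ext hL)⟩

/-- A homotopy invariant function takes the same value on the projections of two paths with the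
same end points. -/
theorem apply_projPath_eq {F : PathSpaceFrom n x₀ → ℂ} (hF : F ∈ homotopyInvariantFrom n x₀)
    {p q : PathSpaceFrom n (e : Y)} (h : p.1 1 = q.1 1) :
    F (hπ.projPath e p) = F (hπ.projPath e q) := by
  have := hπ.simplyConnectedSpace
  refine hF _ _ ?_
  let a : Path (e : Y) (q.1 1) := ⟨(p.1 : C(unitInterval, Y)), p.2, h⟩
  let b : Path (e : Y) (q.1 1) := ⟨(q.1 : C(unitInterval, Y)), q.2, rfl⟩
  exact (SimplyConnectedSpace.paths_homotopic a b).map ⟨π, hπ.contMDiff.continuous⟩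

theorem exists_pathFrom [IsManifold (𝓡 n) ∞ Y] (hπ : IsSmoothUniversalCovering n π)
    (e : π ⁻¹' {x₀}) (y : Y) :
    ∃ p : PathSpaceFrom n (e : Y), p.1 1 = y := by
  have := hπ.simplyConnectedSpace
  obtain ⟨p, h₀, h₁⟩ := exists_path (n := n) (e : Y) y
  exact ⟨⟨p, h₀⟩, h₁⟩

variable [IsManifold (𝓡 n) ∞ X]

/-- The smooth functions on the covering space given by integration along paths starting at the
base point of a combination of iterated integrals of length less than `k`. -/
def pathPrimitives (k : ℕ) : Submodule ℂ (smoothFunctions n Y) where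
  carrier := {f | ∃ G ∈ iteratedIntegralsLT n X k, ∀ p : PathSpaceFrom n (e : Y),
    (f : Y → ℂ) (p.1 1) = G (hπ.mapPath p.1)}
  zero_mem' := ⟨0, Submodule.zero_mem _, fun _ => rfl⟩
  add_mem' := fun ⟨G, hG, h⟩ ⟨G', hG', h'⟩ => ⟨G + G', Submodule.add_mem _ hG hG',
    fun p => congrArg₂ (· + ·) (h p) (h' p)⟩
  smul_mem' := fun c _ ⟨G, hG, h⟩ => ⟨c • G, Submodule.smul_mem _ c hG,
    fun p => congrArg (c • ·) (h p)⟩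

theorem pathPrimitives_mono : Monotone (hπ.pathPrimitives e) := fun _ _ h _ ⟨G, hG, hf⟩ =>
  ⟨G, iteratedIntegralsLT_mono h hG, hf⟩

variable [IsManifold (𝓡 n) ∞ Y]

theorem eq_zero_of_mem_pathPrimitives_zero {f : smoothFunctions n Y}
    (hf : f ∈ hπ.pathPrimitives e 0) : f = 0 := by
  obtain ⟨G, hG, h⟩ := hf
  refine Subtype.ext (funext fun y => ?_)
  obtain ⟨p, rfl⟩ := hπ.exists_pathFrom e y
  rw [h p, eq_zero_of_mem_iteratedIntegralsLT_zero hG]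
  rfl

/-- The operators `γ - 1` lower the length of iterated integrals. -/
theorem deckRep_sub_mem (k : ℕ) (γ : FundamentalGroup X x₀) (f : smoothFunctions n Y)
    (hf : f ∈ hπ.pathPrimitives e (k + 1)) :
    hπ.deckRep e γ f - f ∈ hπ.pathPrimitives e k := by
  obtain ⟨F, hF, hf⟩ := hf
  obtain ⟨τ, hτ⟩ := hπ.exists_pathFrom e (hπ.deck e γ e)
  obtain ⟨G, hG, h⟩ := exists_concat_eq_add hF (hπ.mapPath τ.1)
  -- No homotopy invariance of `G` has to be checked: the difference is already a function on the
  -- covering, and the formula is verified path by path.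
  refine ⟨G, hG, fun p => ?_⟩
  have h₁ : τ.1 1 = hπ.deckPath e γ p.1 0 := by rw [hτ, deckPath_apply, p.2]
  -- This path ends at `γ (p 1)`, while its projection is that of `τ` followed by that of `p`, since
  -- deck transformations disappear under `π`.
  have h₂ := hf ⟨concat τ.1 (hπ.deckPath e γ p.1) h₁, (concat_zero h₁).trans τ.2⟩
  simp only [concat_one, mapPath_concat, h, mapPath_deckPath, deckPath_apply] at h₂
  change (f : Y → ℂ) (hπ.deck e γ (p.1 1)) - (f : Y → ℂ) (p.1 1) = _
  rw [h₂, hf p, add_sub_cancel_left]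

theorem deckRep_mem (k : ℕ) (γ : FundamentalGroup X x₀) (f : smoothFunctions n Y)
    (hf : f ∈ hπ.pathPrimitives e k) : hπ.deckRep e γ f ∈ hπ.pathPrimitives e k := by
  have h := hπ.deckRep_sub_mem e k γ f (hπ.pathPrimitives_mono e k.le_succ hf)
  simpa using Submodule.add_mem _ h hf

theorem pathPrimitives_le_higherInvariants (s : ℕ) :
    hπ.pathPrimitives e s ≤ higherInvariants (hπ.deckRep e) s := fun _ hf _ hj =>
  hπ.eq_zero_of_mem_pathPrimitives_zero e
    (lift_mem_of_mem_augmentationIdeal_pow (hπ.deckRep e) (hπ.deckRep_mem e)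
      (hπ.deckRep_sub_mem e) s 0 hj (by rwa [zero_add]))

/-- A function on the covering space given by iterated integrals along paths starting at the base
point is smooth. -/
theorem contMDiff_of_forall_path {k : ℕ} {F : PathSpace n X → ℂ}
    (hF : F ∈ iteratedIntegralsLT n X k) {f : Y → ℂ}
    (hf : ∀ p : PathSpaceFrom n (e : Y), f (p.1 1) = F (hπ.mapPath p.1)) :
    ContMDiff (𝓡 n) 𝓘(ℝ, ℂ) ∞ f := by
  intro y
  obtain ⟨p, hp⟩ := hπ.exists_pathFrom e y
  obtain ⟨K, κ, hK, hK₀, hκ, hκK⟩ := exists_smooth_parametrization (n := n) y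
  obtain ⟨A, hA, hFA⟩ := exists_contDiff_concat_radialPath hF (hπ.mapPath p.1)
    (hπ.contMDiff.comp hK)
  refine (hA.contMDiff.contMDiffAt.comp y hκ).congr_of_eventuallyEq ?_
  -- For `z` near `y`, the value at `z` is computed along the fixed path to `y` followed by the
  -- radial path with coordinate `κ z`.
  filter_upwards [hκK] with z hz
  have h : p.1 1 = radialPath hK (κ z) 0 := by rw [radialPath_zero, hK₀, hp]
  have h₁ := hf ⟨concat p.1 (radialPath hK (κ z)) h, (concat_zero h).trans p.2⟩
  rw [concat_one, radialPath_one, hz, mapPath_concat] at h₁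
  exact h₁.trans (hFA (κ z) (congrArg π h))

theorem exists_mem_iteratedIntegralsLT {s : ℕ} {F : PathSpaceFrom n x₀ → ℂ}
    (hF : F ∈ homIteratedIntegralsFrom n x₀ s) :
    ∃ G ∈ iteratedIntegralsLT n X (s + 1), ∀ p, F p = G p.1 := by
  obtain ⟨G, hG, rfl⟩ := hF.1
  exact ⟨G, iteratedIntegrals_le s hG, fun _ => rfl⟩

/-- The value of `F` on the projection of a smooth path from the base point to `y`. -/
def integrate (F : PathSpaceFrom n x₀ → ℂ) (y : Y) : ℂ :=
  F (hπ.projPath e (hπ.exists_pathFrom e y).choose)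

theorem integrate_apply {s : ℕ} {F : PathSpaceFrom n x₀ → ℂ}
    (hF : F ∈ homIteratedIntegralsFrom n x₀ s) (p : PathSpaceFrom n (e : Y)) :
    hπ.integrate e F (p.1 1) = F (hπ.projPath e p) :=
  hπ.apply_projPath_eq e hF.2 (hπ.exists_pathFrom e (p.1 1)).choose_spec

theorem contMDiff_integrate {s : ℕ} {F : PathSpaceFrom n x₀ → ℂ}
    (hF : F ∈ homIteratedIntegralsFrom n x₀ s) :
    ContMDiff (𝓡 n) 𝓘(ℝ, ℂ) ∞ (hπ.integrate e F) := by
  obtain ⟨G, hG, h⟩ := exists_mem_iteratedIntegralsLT hF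
  exact hπ.contMDiff_of_forall_path e hG fun p => (hπ.integrate_apply e hF p).trans (h _)

theorem integrate_mem_higherInvariants {s : ℕ} {F : PathSpaceFrom n x₀ → ℂ}
    (hF : F ∈ homIteratedIntegralsFrom n x₀ s) :
    (⟨hπ.integrate e F, hπ.contMDiff_integrate e hF⟩ : smoothFunctions n Y) ∈
      higherInvariants (hπ.deckRep e) (s + 1) := by
  obtain ⟨G, hG, h⟩ := exists_mem_iteratedIntegralsLT hF
  exact hπ.pathPrimitives_le_higherInvariants e (s + 1)
    ⟨G, hG, fun p => (hπ.integrate_apply e hF p).trans (h _)⟩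

end IsSmoothUniversalCovering

end

/-! ### The integration map and its injectivity. -/

theorem mainTheorem2 (n : ℕ) {X Y : Type*}
    [TopologicalSpace X] [T2Space X] [SecondCountableTopology X] [ConnectedSpace X]
    [ChartedSpace (EuclideanSpace ℝ (Fin n)) X] [IsManifold (𝓡 n) ∞ X]
    [TopologicalSpace Y] [ChartedSpace (EuclideanSpace ℝ (Fin n)) Y] [IsManifold (𝓡 n) ∞ Y]
    (π : Y → X) (hπ : IsSmoothUniversalCovering n π)
    (x₀ : X) (e : π ⁻¹' {x₀}) (s : ℕ) :
    (∀ y : Y, ∃ p : PathSpaceFrom n (e : Y), p.1 1 = y) ∧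
    ∃ Ψ : homIteratedIntegralsFrom n x₀ s →ₗ[ℂ] higherInvariants (hπ.deckRep e) (s + 1),
      (∀ (F : homIteratedIntegralsFrom n x₀ s) (p : PathSpaceFrom n (e : Y)),
        (Ψ F : Y → ℂ) (p.1 1) = (F : PathSpaceFrom n x₀ → ℂ) (hπ.projPath e p)) ∧
      Function.Injective Ψ := by
  refine ⟨hπ.exists_pathFrom e,
    { toFun := fun F => ⟨⟨hπ.integrate e F, hπ.contMDiff_integrate e F.2⟩,
        hπ.integrate_mem_higherInvariants e F.2⟩
      map_add' := fun _ _ => rfl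
      map_smul' := fun _ _ => rfl }, fun F p => hπ.integrate_apply e F.2 p, fun F F' h => ?_⟩
  refine Subtype.ext (funext fun q => ?_)
  -- After lifting `q`, the value of each functional on it is the value of the corresponding
  -- function at the end point of the lift.
  obtain ⟨p, rfl⟩ := hπ.exists_projPath_eq e q
  rw [← hπ.integrate_apply e F.2 p, ← hπ.integrate_apply e F'.2 p]
  exact congrArg (fun f : higherInvariants (hπ.deckRep e) (s + 1) =>
    ((f : smoothFunctions n Y) : Y → ℂ) (p.1 1)) h
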